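/- Let $\Gamma$ be a finitely generated, non-amenable (discrete) group with neutral element $id$. For a probability measure $\mu$ on $\Gamma$ let $\mu^n$ be its $n$-th convolution power, $H(\mu)=\sum_{x}(-\log\mu(x))\mu(x)$ its entropy, $h(\mu)=\lim_{n\to\infty}\frac1n H(\mu^n)$ its asymptotic entropy, $G^\mu(x)=\sum_{n\ge0}\mu^n(x)$ its Green function and $d_G^\mu(x,y)=\log G^\mu(id)-\log G^\mu(x^{-1}y)$ its (possibly non-symmetric) Green metric; for a function $d$ on $\Gamma\times\Gamma$ let $\ell(\mu;d)=\lim_{n\to\infty}\frac1n\sum_{x}d(id,x)\mu^n(x)$ be the rate of escape. Let $(\mu_\lambda)_{\lambda\in[-1,1]}$ be probability measures on $\Gamma$, not necessarily symmetric, such that the support of $\mu_0$ generates $\Gamma$ as a semigroup and $H(\mu_0)<\infty$. Assume that, with the convention $\log 0=-\infty$, $$\log\mu_\lambda(a)=\log\mu_0(a)+\lambda\,\nu(a)+\lambda\,o_\lambda(a)\qquad\text{for all }\lambda\in[-1,1],\ a\in\Gamma,$$ where $\nu:\Gamma\to\mathbb R$ is bounded and the real numbers $o_\lambda(a)$ converge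 to $0$ as $\lambda\to0$ ($\lambda\neq0$), uniformly in $a\in\Gamma$. Then $0<G^{\mu_0}(x)<\infty$ for all $x\in\Gamma$; for all sufficiently small $\lambda>0$ the sums and limits defining $h(\mu_\lambda)$ and $\ell(\mu_\lambda;d_G^0)$, where $d_G^0:=d_G^{\mu_0}$, converge to finite values; and $$\lim_{\lambda\to0+}\frac1\lambda\big(h(\mu_\lambda)-\ell(\mu_\lambda;d_G^0)\big)=0.$$ -/

import Mathlib

open Filter Topology
open scoped ENNReal

namespace GreenSpeed

/-- A discrete group is amenable if it carries a left-invariant, finitely additive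
probability measure defined on all of its subsets. -/
def IsAmenable (Γ : Type*) [Group Γ] : Prop :=
  ∃ m : Set Γ → ℝ, (∀ A, 0 ≤ m A) ∧ m Set.univ = 1 ∧
    (∀ A B, Disjoint A B → m (A ∪ B) = m A + m B) ∧
    ∀ (g : Γ) (A : Set Γ), m ((fun x => g * x) '' A) = m A

/-- The `n`-th convolution power `μⁿ` of a probability measure `μ` on a group: the law of a product
of `n` independent elements distributed according to `μ`. -/
noncomputable def convPow {Γ : Type*} [Group Γ] (μ : PMF Γ) : ℕ → PMF Γ
  | 0 => PMF.pure 1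
  | n + 1 => (convPow μ n).bind fun x => μ.map fun a => x * a

/-- The entropy `H(μ) = ∑ₓ (-log μ(x)) μ(x)` is finite.  All the terms are nonnegative. -/
def HasFiniteEntropy {Γ : Type*} (μ : PMF Γ) : Prop :=
  Summable fun x => Real.negMulLog (μ x).toReal

/-- The entropy `H(μ) = ∑ₓ (-log μ(x)) μ(x)`, meaningful when it is finite. -/
noncomputable def entropy {Γ : Type*} (μ : PMF Γ) : ℝ :=
  ∑' x, Real.negMulLog (μ x).toReal

/-- The Green function `G^μ(x) = ∑ₙ μⁿ(x)`, with values in `[0, ∞]`. -/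
noncomputable def green {Γ : Type*} [Group Γ] (μ : PMF Γ) (x : Γ) : ℝ≥0∞ :=
  ∑' n, convPow μ n x

/-- The Green metric `d_G^μ(x, y) = log G^μ(id) - log G^μ(x⁻¹ y)`, meaningful when the Green
function is positive and finite. -/
noncomputable def greenMetric {Γ : Type*} [Group Γ] (μ : PMF Γ) (x y : Γ) : ℝ :=
  Real.log (green μ 1).toReal - Real.log (green μ (x⁻¹ * y)).toReal

/-- The `n`-th step of the walk has finite mean distance to the neutral element. -/
def HasFiniteMean {Γ : Type*} [Group Γ] (μ : PMF Γ) (d : Γ → Γ → ℝ) (n : ℕ) : Prop :=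
  Summable fun x => d 1 x * (convPow μ n x).toReal

/-- The mean distance `∑ₓ d(id, x) μⁿ(x)` to the neutral element after `n` steps. -/
noncomputable def meanDist {Γ : Type*} [Group Γ] (μ : PMF Γ) (d : Γ → Γ → ℝ) (n : ℕ) : ℝ :=
  ∑' x, d 1 x * (convPow μ n x).toReal

/-- The asymptotic entropy `h(μ) = lim H(μⁿ) / n`, meaningful when the limit exists. -/
noncomputable def asymptoticEntropy {Γ : Type*} [Group Γ] (μ : PMF Γ) : ℝ :=
  limUnder atTop fun n : ℕ => entropy (convPow μ n) / n

/-- The rate of escape `ℓ(μ; d) = lim (1/n) ∑ₓ d(id, x) μⁿ(x)`, meaningful when the limit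
exists. -/
noncomputable def rateOfEscape {Γ : Type*} [Group Γ] (μ : PMF Γ) (d : Γ → Γ → ℝ) : ℝ :=
  limUnder atTop fun n : ℕ => meanDist μ d n / n

/-- The sums and the limit that define the asymptotic entropy converge. -/
def AsymptoticEntropyExists {Γ : Type*} [Group Γ] (μ : PMF Γ) : Prop :=
  (∀ n, HasFiniteEntropy (convPow μ n)) ∧
    Tendsto (fun n : ℕ => entropy (convPow μ n) / n) atTop (𝓝 (asymptoticEntropy μ))

/-- The sums and the limit that define the rate of escape converge. -/
def RateOfEscapeExists {Γ : Type*} [Group Γ] (μ : PMF Γ) (d : Γ → Γ → ℝ) : Prop :=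
  (∀ n, HasFiniteMean μ d n) ∧
    Tendsto (fun n : ℕ => meanDist μ d n / n) atTop (𝓝 (rateOfEscape μ d))

/-- The curve `t ↦ μ_t`, `t ∈ [-1, 1]`, of probability measures satisfies
`log μ_t(a) = log μ₀(a) + t ν(a) + t o_t(a)` for all `a`, with `ν` bounded and with `o_t(a) → 0` as
`t → 0`, uniformly in `a`.  The logarithm takes its values in `[-∞, 0]` with `log 0 = -∞`, so that
all the `μ_t` have the same support, and outside this support there is no further condition. -/
def IsRegularCurve {Γ : Type*} (μ : ℝ → PMF Γ) (ν : Γ → ℝ) (o : ℝ → Γ → ℝ) : Prop :=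
  (∀ t ∈ Set.Icc (-1 : ℝ) 1, ∀ a : Γ,
    ENNReal.log (μ t a) = ENNReal.log (μ 0 a) + ((t * ν a + t * o t a : ℝ) : EReal)) ∧
  (∃ C : ℝ, ∀ a, |ν a| ≤ C) ∧
  TendstoUniformly o (fun _ => 0) (𝓝[≠] 0)

end GreenSpeed

namespace GreenSpeed

/-! Write `P = convOp μ₀`, `G` for the Green function of `μ₀`, `D` for relative entropy and `B` for
a bound of `|ν|`. For small `t > 0` the proof sandwiches the difference: `0 ≤ ℓ(μ_t; d_G⁰) - h(μ_t)
≤ D(μ_t ‖ μ₀) ≤ (t (B + 1))²`, and division by `t` gives the claim.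

Upper bound. Since `G ≥ μ₀ⁿ` pointwise, the mean of `d_G⁰` under `μ_tⁿ` is at most `log G(id) +
H(μ_tⁿ) + D(μ_tⁿ ‖ μ₀ⁿ)`. Relative entropy is subadditive under convolution (`relEntropy_conv_le`),
so the last term is at most `n D(μ_t ‖ μ₀)`. This is of second order in `t`, because the first-order
terms cancel between two measures of mass one (`relEntropy_le_sq`).

Lower bound. This is where non-amenability enters: it makes `μ₀ᵏ(x)` decay exponentially in `k`,
uniformly in `x` (`exists_exponential_decay`). The function `G` has infinite total mass, so it is
not dominated by a multiple of a probability measure; but for each `θ < 1` the decay yields a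
probability measure `q` with `G ≤ e^K q^θ` (`exists_pmf_green_le`). Gibbs' inequality against `q`
gives `θ H(μ_tⁿ) ≤ E d_G⁰ + const`. Dividing by `n`, then letting `θ → 1`, gives `h ≤ ℓ`; closeness
of `μ_t` to `μ₀` plays no role here beyond the existence of the two limits. -/

variable {Γ : Type*} [Group Γ]

/-! ### Convolution of probability measures and sums against it. -/

/-- The convolution of two probability measures on a group. -/
noncomputable def conv (p q : PMF Γ) : PMF Γ :=
  p.bind fun x => q.map fun a => x * a

theorem map_mul_left_apply (q : PMF Γ) (y x : Γ) :
    (q.map fun a => y * a) x = q (y⁻¹ * x) := by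
  classical
  rw [PMF.map_apply, tsum_eq_single (y⁻¹ * x)]
  · simp
  · intro b hb
    rw [if_neg]
    rintro rfl
    simp at hb

theorem conv_apply (p q : PMF Γ) (x : Γ) : conv p q x = ∑' y, p y * q (y⁻¹ * x) := by
  simp only [conv, PMF.bind_apply, map_mul_left_apply]

theorem conv_assoc (p q r : PMF Γ) : conv (conv p q) r = conv p (conv q r) := by
  simp only [conv, PMF.map, PMF.bind_bind, PMF.pure_bind, Function.comp_def, mul_assoc]

theorem pure_one_conv (p : PMF Γ) : conv (PMF.pure 1) p = p := by
  simp only [conv, PMF.pure_bind, one_mul]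
  exact PMF.map_id p

theorem conv_pure_one (p : PMF Γ) : conv p (PMF.pure 1) = p := by
  simp only [conv, PMF.pure_map, mul_one, PMF.bind_pure]

theorem convPow_zero (μ : PMF Γ) : convPow μ 0 = PMF.pure 1 := rfl

theorem convPow_succ (μ : PMF Γ) (n : ℕ) : convPow μ (n + 1) = conv (convPow μ n) μ := rfl

theorem convPow_one (μ : PMF Γ) : convPow μ 1 = μ := by
  rw [convPow_succ, convPow_zero, pure_one_conv]

theorem convPow_add (μ : PMF Γ) (m n : ℕ) :
    convPow μ (m + n) = conv (convPow μ m) (convPow μ n) := by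
  induction n with
  | zero => rw [add_zero, convPow_zero, conv_pure_one]
  | succ n ih => rw [← add_assoc, convPow_succ, ih, convPow_succ, conv_assoc]

theorem convPow_succ' (μ : PMF Γ) (n : ℕ) : convPow μ (n + 1) = conv μ (convPow μ n) := by
  rw [add_comm, convPow_add, convPow_one]

theorem mul_le_conv (p q : PMF Γ) (y a : Γ) : p y * q a ≤ conv p q (y * a) := by
  rw [conv_apply]
  refine le_trans ?_ (ENNReal.le_tsum y)
  simp

theorem conv_le_mul {p q p' q' : PMF Γ} {c c' : ℝ≥0∞} (hp : ∀ x, p x ≤ c * p' x)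
    (hq : ∀ x, q x ≤ c' * q' x) (x : Γ) : conv p q x ≤ c * c' * conv p' q' x := by
  rw [conv_apply, conv_apply, ← ENNReal.tsum_mul_left]
  refine ENNReal.tsum_le_tsum fun y => ?_
  calc p y * q (y⁻¹ * x) ≤ (c * p' y) * (c' * q' (y⁻¹ * x)) := mul_le_mul' (hp _) (hq _)
    _ = _ := by ring

theorem convPow_le_mul {p q : PMF Γ} {c : ℝ≥0∞} (h : ∀ x, p x ≤ c * q x) (n : ℕ) (x : Γ) :
    convPow p n x ≤ c ^ n * convPow q n x := by
  induction n generalizing x with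
  | zero => simp [convPow_zero]
  | succ n ih =>
    rw [convPow_succ, convPow_succ, pow_succ]
    exact conv_le_mul ih h x

theorem hasSum_toReal {α : Type*} (p : PMF α) : HasSum (fun x => (p x).toReal) 1 := by
  have h := ENNReal.hasSum_toReal (f := fun x => p x) (by rw [p.tsum_coe]; exact ENNReal.one_ne_top)
  rwa [← ENNReal.tsum_toReal_eq p.apply_ne_top, p.tsum_coe, ENNReal.toReal_one] at h

theorem toReal_le_one {α : Type*} (p : PMF α) (x : α) : (p x).toReal ≤ 1 :=
  ENNReal.toReal_le_of_le_ofReal zero_le_one (by simpa using p.coe_le_one x)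

theorem hasSum_conv_apply (p q : PMF Γ) (x : Γ) :
    HasSum (fun y => (p y).toReal * (q (y⁻¹ * x)).toReal) (conv p q x).toReal := by
  have hne : ∀ y, p y * q (y⁻¹ * x) ≠ ⊤ := fun y =>
    ENNReal.mul_ne_top (p.apply_ne_top _) (q.apply_ne_top _)
  have h := ENNReal.hasSum_toReal (f := fun y => p y * q (y⁻¹ * x))
    (by rw [← conv_apply]; exact PMF.apply_ne_top _ _)
  rw [← ENNReal.tsum_toReal_eq hne, ← conv_apply] at h
  simpa only [ENNReal.toReal_mul] using h

/-- A sum against a convolution is a double sum. -/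
theorem hasSum_conv {p q : PMF Γ} {F : Γ → ℝ} {S : ℝ}
    (h : HasSum (fun z : Γ × Γ => (p z.1).toReal * (q z.2).toReal * F (z.1 * z.2)) S) :
    HasSum (fun x => (conv p q x).toReal * F x) S := by
  let e : Γ × Γ ≃ Γ × Γ :=
    { toFun := fun z => (z.2, z.2⁻¹ * z.1)
      invFun := fun z => (z.1 * z.2, z.1)
      left_inv := fun z => by simp
      right_inv := fun z => by simp }
  have h' : HasSum (fun z : Γ × Γ =>
      (p z.2).toReal * (q (z.2⁻¹ * z.1)).toReal * F z.1) S := by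
    have h1 := (e.hasSum_iff).2 h
    simpa [e, Function.comp_def] using h1
  exact h'.prod_fiberwise fun x => (hasSum_conv_apply p q x).mul_right (F x)

theorem hasSum_prod_mul_add {α : Type*} {p q : PMF α} {A B : α → ℝ} {a b : ℝ}
    (hA : HasSum (fun x => (p x).toReal * A x) a) (hB : HasSum (fun x => (q x).toReal * B x) b) :
    HasSum (fun z : α × α => (p z.1).toReal * (q z.2).toReal * (A z.1 + B z.2)) (a + b) := by
  have hA' : HasSum (fun z : α × α => ((p z.1).toReal * A z.1) * (q z.2).toReal) (a * 1) := by
    have h := summable_mul_of_summable_norm hA.summable.norm (hasSum_toReal q).summable.norm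
    exact hA.mul (hasSum_toReal q) h
  have hB' : HasSum (fun z : α × α => (p z.1).toReal * ((q z.2).toReal * B z.2)) (1 * b) := by
    have h := summable_mul_of_summable_norm (hasSum_toReal p).summable.norm hB.summable.norm
    exact (hasSum_toReal p).mul hB h
  have h := hA'.add hB'
  rw [mul_one, one_mul] at h
  have heq : (fun z : α × α => (p z.1).toReal * (q z.2).toReal * (A z.1 + B z.2)) =
      fun z => ((p z.1).toReal * A z.1) * (q z.2).toReal +
        (p z.1).toReal * ((q z.2).toReal * B z.2) := by
    funext z
    ring
  rw [heq]
  exact h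

/-- The mean of a nonnegative subadditive function under a convolution. -/
theorem summable_conv_and_tsum_le {p q : PMF Γ} {F A B : Γ → ℝ} (hF : ∀ x, 0 ≤ F x)
    (hle : ∀ y a, p y ≠ 0 → q a ≠ 0 → F (y * a) ≤ A y + B a)
    (hA : Summable fun x => (p x).toReal * A x) (hB : Summable fun x => (q x).toReal * B x) :
    (Summable fun x => (conv p q x).toReal * F x) ∧
      ∑' x, (conv p q x).toReal * F x ≤
        ∑' x, (p x).toReal * A x + ∑' x, (q x).toReal * B x := by
  have h := hasSum_prod_mul_add hA.hasSum hB.hasSum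
  have hle' : ∀ z : Γ × Γ, (p z.1).toReal * (q z.2).toReal * F (z.1 * z.2) ≤
      (p z.1).toReal * (q z.2).toReal * (A z.1 + B z.2) := by
    intro z
    by_cases h1 : p z.1 = 0
    · simp [h1]
    by_cases h2 : q z.2 = 0
    · simp [h2]
    exact mul_le_mul_of_nonneg_left (hle _ _ h1 h2) (by positivity)
  have hs : Summable fun z : Γ × Γ => (p z.1).toReal * (q z.2).toReal * F (z.1 * z.2) :=
    Summable.of_nonneg_of_le
      (fun z => mul_nonneg (by positivity) (hF _)) hle' h.summable
  have hc := hasSum_conv hs.hasSum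
  refine ⟨hc.summable, ?_⟩
  rw [hc.tsum_eq, ← h.tsum_eq]
  exact hs.tsum_le_tsum hle' h.summable

/-! ### Potential theory of the Green function. -/

theorem green_eq_pure_add (μ : PMF Γ) (x : Γ) :
    green μ x = PMF.pure (1 : Γ) x + ∑' a, μ a * green μ (a⁻¹ * x) := by
  have h : ∑' a, μ a * green μ (a⁻¹ * x) = ∑' n, convPow μ (n + 1) x := by
    simp only [green, ← ENNReal.tsum_mul_left]
    rw [ENNReal.tsum_comm]
    simp only [convPow_succ', conv_apply]
  have h0 : ∑' n, convPow μ n x = convPow μ 0 x + ∑' n, convPow μ (n + 1) x :=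
    tsum_eq_zero_add' ENNReal.summable
  rw [h, green, h0, convPow_zero]

/-- A supersolution of the equation of the Green function dominates it. -/
theorem mul_green_le {μ : PMF Γ} {u : Γ → ℝ≥0∞} {c : ℝ≥0∞}
    (h : ∀ x, c * PMF.pure (1 : Γ) x + ∑' a, μ a * u (a⁻¹ * x) ≤ u x) (x : Γ) :
    c * green μ x ≤ u x := by
  have key : ∀ n x, c * ∑ k ∈ Finset.range n, convPow μ k x ≤ u x := by
    intro n
    induction n with
    | zero => simp
    | succ n ih =>
      intro x
      refine le_trans ?_ (h x)
      rw [Finset.sum_range_succ', mul_add, add_comm, convPow_zero]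
      gcongr
      simp only [convPow_succ', conv_apply]
      rw [← Summable.tsum_finsetSum (fun _ _ => ENNReal.summable), ← ENNReal.tsum_mul_left]
      refine ENNReal.tsum_le_tsum fun a => ?_
      rw [← Finset.mul_sum, mul_left_comm]
      gcongr
      exact ih _
  rw [green, ENNReal.tsum_eq_iSup_nat, ENNReal.mul_iSup]
  exact iSup_le fun n => key n x

theorem green_one_ne_zero (μ : PMF Γ) : green μ 1 ≠ 0 := by
  intro h0
  have : convPow μ 0 (1 : Γ) ≤ green μ 1 := ENNReal.le_tsum 0
  rw [h0, convPow_zero] at this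
  simp at this

/-- The domination principle for the Green function. -/
theorem div_green_one_mul_green_le {μ : PMF Γ} (hfin : green μ 1 ≠ ⊤) {v : Γ → ℝ≥0∞}
    (hv : ∀ x, ∑' a, μ a * v (a⁻¹ * x) ≤ v x) (x : Γ) :
    v 1 / green μ 1 * green μ x ≤ v x := by
  classical
  set c := v 1 / green μ 1 with hc
  have hc1 : c * green μ 1 = v 1 := ENNReal.div_mul_cancel (green_one_ne_zero μ) hfin
  have hTc : ∀ x, c * green μ x =
      c * PMF.pure (1 : Γ) x + ∑' a, μ a * (c * green μ (a⁻¹ * x)) := by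
    intro x
    rw [green_eq_pure_add μ x, mul_add, ← ENNReal.tsum_mul_left]
    simp only [mul_left_comm]
  -- The minimum of `c G` and `v` is still a supersolution with source `c` at the identity: there `c
  -- G = v` by the choice of `c`, and elsewhere there is no source. Minimality of `c G` then puts it
  -- below this minimum.
  have hm := mul_green_le (μ := μ) (c := c) (u := fun x => min (c * green μ x) (v x)) (fun x => by
    have h1 : ∑' a, μ a * min (c * green μ (a⁻¹ * x)) (v (a⁻¹ * x)) ≤
        ∑' a, μ a * (c * green μ (a⁻¹ * x)) :=
      ENNReal.tsum_le_tsum fun a => by gcongr; exact min_le_left _ _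
    have h2 : ∑' a, μ a * min (c * green μ (a⁻¹ * x)) (v (a⁻¹ * x)) ≤ v x :=
      le_trans (ENNReal.tsum_le_tsum fun a => by gcongr; exact min_le_right _ _) (hv x)
    have h3 : c * PMF.pure (1 : Γ) x +
        ∑' a, μ a * min (c * green μ (a⁻¹ * x)) (v (a⁻¹ * x)) ≤ c * green μ x := by
      rw [hTc x]
      gcongr
    refine le_min h3 ?_
    by_cases hx : x = 1
    · subst hx
      rw [← hc1]
      exact h3
    · simpa [PMF.pure_apply, hx] using h2) x
  exact hm.trans (min_le_right _ _)

theorem green_le_green_one {μ : PMF Γ} (hfin : green μ 1 ≠ ⊤) (x : Γ) :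
    green μ x ≤ green μ 1 := by
  have h := div_green_one_mul_green_le (μ := μ) hfin (v := fun _ => 1)
    (fun x => by simp [μ.tsum_coe]) x
  rw [one_div, mul_comm, ← div_eq_mul_inv] at h
  simpa using (ENNReal.div_le_iff (green_one_ne_zero μ) hfin).1 h

/-- The translate `x ↦ G(x y)` is superharmonic by the Green equation, so the domination principle
applies. This becomes the triangle inequality of the Green metric. -/
theorem green_mul_green_le {μ : PMF Γ} (hfin : green μ 1 ≠ ⊤) (x y : Γ) :
    green μ x * green μ y ≤ green μ 1 * green μ (x * y) := by
  have h := div_green_one_mul_green_le (μ := μ) hfin (v := fun x => green μ (x * y))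
    (fun x => by
      conv_rhs => rw [green_eq_pure_add]
      simp only [mul_assoc]
      exact le_add_self) x
  rw [one_mul] at h
  calc green μ x * green μ y = green μ 1 * (green μ y / green μ 1 * green μ x) := by
        rw [← mul_assoc, ENNReal.mul_div_cancel (green_one_ne_zero μ) hfin, mul_comm]
    _ ≤ _ := by gcongr

theorem green_pos {μ : PMF Γ} (hgen : Subsemigroup.closure μ.support = ⊤) (x : Γ) :
    0 < green μ x := by
  have h : ∃ n, convPow μ n x ≠ 0 := by
    have hx : x ∈ Subsemigroup.closure μ.support := by rw [hgen]; trivial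
    induction hx using Subsemigroup.closure_induction with
    | mem x hx => exact ⟨1, by rw [convPow_one]; exact (PMF.mem_support_iff _ _).1 hx⟩
    | mul x y _ _ hx hy =>
      obtain ⟨m, hm⟩ := hx
      obtain ⟨n, hn⟩ := hy
      refine ⟨m + n, fun h0 => mul_ne_zero hm hn ?_⟩
      rw [convPow_add] at h0
      exact le_antisymm ((mul_le_conv _ _ x y).trans h0.le) zero_le
  obtain ⟨n, hn⟩ := h
  exact lt_of_lt_of_le (pos_iff_ne_zero.2 hn) (ENNReal.le_tsum (f := fun n => convPow μ n x) n)

/-! ### Regular representation, amenability and spectral gap. -/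

theorem hasSum_sq_norm {α : Type*} (f : lp (fun _ : α => ℝ) 2) : HasSum (fun x => f x ^ 2) (‖f‖ ^ 2) := by
  have h := lp.hasSum_norm (p := 2) (by norm_num) f
  simpa using h

/-- The left regular representation on square summable functions. -/
noncomputable def leftReg (g : Γ) : lp (fun _ : Γ => ℝ) 2 →ₗᵢ[ℝ] lp (fun _ : Γ => ℝ) 2 where
  toFun f := ⟨fun x => f (g⁻¹ * x), by
    refine memℓp_gen ?_
    have h := (lp.memℓp f).summable (by norm_num)
    exact h.comp_injective (mul_right_injective g⁻¹)⟩
  map_add' f h := by ext x; rfl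
  map_smul' c f := by ext x; rfl
  norm_map' f := by
    have h1 := hasSum_sq_norm f
    have h2 : HasSum ((fun x => f x ^ 2) ∘ Equiv.mulLeft g⁻¹) (‖f‖ ^ 2) :=
      (Equiv.mulLeft g⁻¹).hasSum_iff.2 h1
    exact (sq_eq_sq₀ (norm_nonneg _) (norm_nonneg _)).1 ((hasSum_sq_norm _).unique h2)

theorem leftReg_apply (g : Γ) (f : lp (fun _ : Γ => ℝ) 2) (x : Γ) :
    leftReg g f x = f (g⁻¹ * x) := rfl

theorem leftReg_mul (g h : Γ) (f : lp (fun _ : Γ => ℝ) 2) :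
    leftReg (g * h) f = leftReg g (leftReg h f) := by
  ext x
  simp only [leftReg_apply, mul_inv_rev, mul_assoc]

/-- Cauchy-Schwarz applied to `u² - v² = (u - v)(u + v)`. -/
theorem abs_tsum_indicator_sq_sub_le {α : Type*} (A : Set α) (u v : lp (fun _ : α => ℝ) 2) :
    |∑' x, A.indicator (fun x => u x ^ 2) x - ∑' x, A.indicator (fun x => v x ^ 2) x| ≤
      ‖u - v‖ * ‖u + v‖ := by
  have hc : (2 : ℝ≥0∞).toReal.HolderConjugate (2 : ℝ≥0∞).toReal := by
    norm_num
    exact Real.HolderConjugate.two_two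
  obtain ⟨hs, hle⟩ := lp.tsum_mul_le_mul_norm hc (u - v) (u + v)
  rw [← ((hasSum_sq_norm u).summable.indicator A).tsum_sub
    ((hasSum_sq_norm v).summable.indicator A)]
  refine le_trans ?_ hle
  rw [← Real.norm_eq_abs]
  refine tsum_of_norm_bounded hs.hasSum fun x => ?_
  have hx : ‖(u - v) x‖ * ‖(u + v) x‖ = ‖u x ^ 2 - v x ^ 2‖ := by
    rw [← norm_mul, lp.coeFn_sub, lp.coeFn_add, Pi.sub_apply, Pi.add_apply]
    ring_nf
  rw [hx]
  by_cases h : x ∈ A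
  · simp [h]
  · simp only [Set.indicator_of_notMem h, sub_self, norm_zero]
    exact norm_nonneg _

/-- Almost invariant vectors in the regular representation give an invariant mean. -/
theorem isAmenable_of_almost_invariant {f : ℕ → lp (fun _ : Γ => ℝ) 2} (hf : ∀ n, ‖f n‖ = 1)
    (h : ∀ g, Tendsto (fun n => ‖leftReg g (f n) - f n‖) atTop (𝓝 0)) : IsAmenable Γ := by
  -- Each `f n ^ 2` is a probability density. The invariant mean is the limit of the masses it gives
  -- to `A`, along a nonprincipal ultrafilter.
  set F : Set Γ → ℕ → ℝ := fun A n => ∑' x, A.indicator (fun x => f n x ^ 2) x with hF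
  have hs : ∀ (A : Set Γ) n, Summable (A.indicator fun x => f n x ^ 2) := fun A n =>
    (hasSum_sq_norm (f n)).summable.indicator A
  have h0 : ∀ A n, 0 ≤ F A n := fun A n =>
    tsum_nonneg fun x => Set.indicator_nonneg (fun x _ => sq_nonneg _) x
  have hu : ∀ n, F Set.univ n = 1 := fun n => by
    simp only [hF, Set.indicator_univ]
    rw [(hasSum_sq_norm (f n)).tsum_eq, hf, one_pow]
  have h1 : ∀ A n, F A n ≤ 1 := fun A n => by
    rw [← hu n]
    exact (hs A n).tsum_le_tsum (fun x => Set.indicator_le_indicator_of_subset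
      (Set.subset_univ A) (fun x => sq_nonneg _) x) (hs _ n)
  have hlim : ∀ A, ∃ L, Tendsto (F A) (hyperfilter ℕ) (𝓝 L) := fun A => by
    obtain ⟨L, -, hL⟩ := (isCompact_Icc (a := (0 : ℝ)) (b := 1)).ultrafilter_le_nhds'
      ((hyperfilter ℕ).map (F A)) (Filter.mem_map.2 (Filter.univ_mem' fun n => ⟨h0 A n, h1 A n⟩))
    exact ⟨L, hL⟩
  choose m hm using hlim
  refine ⟨m, fun A => ge_of_tendsto' (hm A) (h0 A), ?_, fun A B hAB => ?_, fun g A => ?_⟩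
  · refine tendsto_nhds_unique (hm Set.univ) ?_
    simp only [funext hu, tendsto_const_nhds]
  · refine tendsto_nhds_unique (hm (A ∪ B)) (((hm A).add (hm B)).congr fun n => ?_)
    simp only [hF]
    rw [← (hs A n).tsum_add (hs B n)]
    simp only [Set.indicator_union_of_disjoint hAB]
  · refine tendsto_nhds_unique (hm _) ?_
    have hd : Tendsto (fun n => F ((fun x => g * x) '' A) n - F A n) atTop (𝓝 0) := by
      have h2 : Tendsto (fun n => ‖leftReg g⁻¹ (f n) - f n‖ * 2) atTop (𝓝 0) := by
        simpa using (h g⁻¹).mul_const 2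
      refine squeeze_zero_norm (fun n => ?_) h2
      have h3 : F ((fun x => g * x) '' A) n =
          ∑' x, A.indicator (fun x => leftReg g⁻¹ (f n) x ^ 2) x := by
        simp only [hF]
        rw [← (Equiv.mulLeft g).tsum_eq]
        refine tsum_congr fun x => ?_
        simp only [Equiv.coe_mulLeft, leftReg_apply, inv_inv]
        by_cases hx : x ∈ A
        · rw [Set.indicator_of_mem hx, Set.indicator_of_mem (Set.mem_image_of_mem _ hx)]
        · rw [Set.indicator_of_notMem hx, Set.indicator_of_notMem]
          rintro ⟨y, hy, hxy⟩
          exact hx (mul_left_cancel hxy ▸ hy)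
      rw [h3, Real.norm_eq_abs]
      refine (abs_tsum_indicator_sq_sub_le A _ _).trans ?_
      gcongr
      refine (norm_add_le _ _).trans ?_
      rw [LinearIsometry.norm_map, hf]
      norm_num
    have h4 := (hd.mono_left (Nat.hyperfilter_le_atTop)).add (hm A)
    simpa using h4

/-- The operator of left convolution by a probability measure. -/
noncomputable def convOp (μ : PMF Γ) : lp (fun _ : Γ => ℝ) 2 →L[ℝ] lp (fun _ : Γ => ℝ) 2 :=
  ∑' a, (μ a).toReal • (leftReg a).toContinuousLinearMap

theorem hasSum_convOp (μ : PMF Γ) :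
    HasSum (fun a => (μ a).toReal • (leftReg a).toContinuousLinearMap) (convOp μ) := by
  refine (Summable.of_norm_bounded (hasSum_toReal μ).summable fun a => ?_).hasSum
  rw [norm_smul, Real.norm_of_nonneg ENNReal.toReal_nonneg]
  exact mul_le_of_le_one_right ENNReal.toReal_nonneg (LinearIsometry.norm_toContinuousLinearMap_le _)

theorem hasSum_convOp_apply (μ : PMF Γ) (f : lp (fun _ : Γ => ℝ) 2) :
    HasSum (fun a => (μ a).toReal • leftReg a f) (convOp μ f) := by
  have h := (ContinuousLinearMap.apply ℝ (lp (fun _ : Γ => ℝ) 2) f).hasSum (hasSum_convOp μ)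
  exact h

theorem hasSum_convOp_apply_apply (μ : PMF Γ) (f : lp (fun _ : Γ => ℝ) 2) (x : Γ) :
    HasSum (fun a => (μ a).toReal * f (a⁻¹ * x)) (convOp μ f x) :=
  (lp.evalCLM ℝ (fun _ : Γ => ℝ) 2 x).hasSum (hasSum_convOp_apply μ f)

/-- The vector `f + convOp μ f` is the `μ`-average of the vectors `f + leftReg b f`, all of norm at
most `2‖f‖`. Hence the norm deficit of one of them, weighted by its mass, is at most the deficit of
the average. -/
theorem mul_sub_norm_add_leftReg_le (μ : PMF Γ) (f : lp (fun _ : Γ => ℝ) 2) (a : Γ) :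
    (μ a).toReal * (2 * ‖f‖ - ‖f + leftReg a f‖) ≤ 2 * ‖f‖ - ‖f + convOp μ f‖ := by
  classical
  have h1 : HasSum (fun b => (μ b).toReal • (f + leftReg b f)) (f + convOp μ f) := by
    have := ((hasSum_toReal μ).smul_const f).add (hasSum_convOp_apply μ f)
    simpa only [one_smul, ← smul_add] using this
  have h2 : HasSum (fun b => (μ b).toReal * (2 * ‖f‖) -
      if b = a then (μ a).toReal * (2 * ‖f‖ - ‖f + leftReg a f‖) else 0)
      (1 * (2 * ‖f‖) - (μ a).toReal * (2 * ‖f‖ - ‖f + leftReg a f‖)) :=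
    ((hasSum_toReal μ).mul_right _).sub (hasSum_ite_eq a _)
  have h3 := tsum_of_norm_bounded h2 (f := fun b => (μ b).toReal • (f + leftReg b f)) fun b => by
    rw [norm_smul, Real.norm_of_nonneg ENNReal.toReal_nonneg]
    split_ifs with hb
    · subst hb
      apply le_of_eq
      ring
    · rw [sub_zero]
      gcongr
      refine (norm_add_le _ _).trans ?_
      rw [LinearIsometry.norm_map, two_mul]
  rw [h1.tsum_eq] at h3
  linarith

/-- The lazy random walk on a non-amenable group has a spectral gap. -/
theorem norm_one_add_convOp_lt_two (hna : ¬ IsAmenable Γ) {μ : PMF Γ}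
    (hgen : Subsemigroup.closure μ.support = ⊤) : ‖1 + convOp μ‖ < 2 := by
  -- Laziness matters: `convOp μ` itself can have norm one, for instance when the support lies in a
  -- coset of an amenable subgroup. With the identity added, near-extremal vectors are almost fixed
  -- by each element of the support.
  by_contra! hcon
  apply hna
  have hex : ∀ n : ℕ, ∃ f : lp (fun _ : Γ => ℝ) 2, ‖f‖ = 1 ∧
      2 - 1 / ((n : ℝ) + 1) ≤ ‖f + convOp μ f‖ := by
    intro n
    by_contra! hn
    have hpos : 0 < 1 / ((n : ℝ) + 1) := by positivity
    have hle1 : 1 / ((n : ℝ) + 1) ≤ 1 := by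
      rw [div_le_one (by positivity)]
      linarith [Nat.cast_nonneg (α := ℝ) n]
    have hb : ‖1 + convOp μ‖ ≤ 2 - 1 / ((n : ℝ) + 1) := by
      refine ContinuousLinearMap.opNorm_le_bound _ (by linarith) fun f => ?_
      by_cases hf : f = 0
      · simp [hf]
      have hf' : ‖f‖ ≠ 0 := norm_ne_zero_iff.2 hf
      have h1 := hn (‖f‖⁻¹ • f) (by rw [norm_smul, norm_inv, norm_norm, inv_mul_cancel₀ hf'])
      rw [map_smul, ← smul_add, norm_smul, norm_inv, norm_norm, inv_mul_lt_iff₀ (by positivity)]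
        at h1
      rw [mul_comm]
      exact h1.le
    linarith
  choose f hf1 hf2 using hex
  have hlim0 : Tendsto (fun n : ℕ => 1 / ((n : ℝ) + 1)) atTop (𝓝 0) :=
    tendsto_one_div_add_atTop_nhds_zero_nat
  refine isAmenable_of_almost_invariant hf1 fun g => ?_
  have hg : g ∈ Subsemigroup.closure μ.support := by rw [hgen]; trivial
  induction hg using Subsemigroup.closure_induction with
  | mem a ha =>
    have hpos : 0 < (μ a).toReal :=
      ENNReal.toReal_pos ((PMF.mem_support_iff _ _).1 ha) (μ.apply_ne_top a)
    -- By the parallelogram law the left side is `4 - x² = (2 - x)(2 + x)` with `x = ‖f n + leftReg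
    -- a (f n)‖ ≤ 2`.
    have h1 : ∀ n, ‖leftReg a (f n) - f n‖ ^ 2 ≤ 4 * ((μ a).toReal⁻¹ * (1 / ((n : ℝ) + 1))) := by
      intro n
      have h2 := mul_sub_norm_add_leftReg_le μ (f n) a
      have h3 := parallelogram_law_with_norm ℝ (f n) (leftReg a (f n))
      have h4 : ‖f n + leftReg a (f n)‖ ≤ 2 := by
        refine (norm_add_le _ _).trans ?_
        rw [LinearIsometry.norm_map, hf1]
        norm_num
      rw [LinearIsometry.norm_map] at h3
      rw [hf1] at h2 h3
      have h5 : 2 - ‖f n + leftReg a (f n)‖ ≤ (μ a).toReal⁻¹ * (1 / ((n : ℝ) + 1)) := by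
        rw [le_inv_mul_iff₀ hpos]
        linarith [hf2 n]
      rw [norm_sub_rev]
      nlinarith [norm_nonneg (f n + leftReg a (f n))]
    have h6 : Tendsto (fun n => ‖leftReg a (f n) - f n‖ ^ 2) atTop (𝓝 0) := by
      refine squeeze_zero (fun n => sq_nonneg _) h1 ?_
      simpa using (hlim0.const_mul (μ a).toReal⁻¹).const_mul 4
    simpa [Real.sqrt_sq (norm_nonneg _)] using h6.sqrt
  | mul x y _ _ hx hy =>
    refine squeeze_zero (fun n => norm_nonneg _) (fun n => ?_) (by simpa using hy.add hx)
    have : leftReg (x * y) (f n) - f n =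
        leftReg x (leftReg y (f n) - f n) + (leftReg x (f n) - f n) := by
      rw [leftReg_mul, map_sub]
      abel
    rw [this]
    refine (norm_add_le _ _).trans ?_
    rw [LinearIsometry.norm_map]

/-! ### Exponential decay and domination of the Green function. -/

/-- The return probabilities of a random walk on a non-amenable group decay exponentially. -/
theorem exists_exponential_decay (hna : ¬ IsAmenable Γ) {μ : PMF Γ}
    (hgen : Subsemigroup.closure μ.support = ⊤) :
    ∃ s : ℝ, 1 < s ∧ ∃ C : ℝ, ∀ k x, s ^ k * (convPow μ k x).toReal ≤ C := by
  classical
  set ρ := ‖1 + convOp μ‖ with hρ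
  have hρ2 : ρ < 2 := norm_one_add_convOp_lt_two hna hgen
  have hρ0 : 0 ≤ ρ := norm_nonneg _
  -- Chosen so that `1/2 < r < 1` and `r ρ < 1`, which is possible exactly because `ρ < 2`. The
  -- first makes `s = r / (1 - r) > 1`, the second makes the Neumann series converge.
  set r : ℝ := 2 / (6 + ρ) * 2 with hr
  have hr0 : 0 < r := by positivity
  have hr1 : 1 / 2 < r := by rw [hr, div_mul_eq_mul_div, lt_div_iff₀ (by positivity)]; linarith
  have hr2 : r < 1 := by rw [hr, div_mul_eq_mul_div, div_lt_one (by positivity)]; linarith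
  set S : lp (fun _ : Γ => ℝ) 2 →L[ℝ] lp (fun _ : Γ => ℝ) 2 := r • (1 + convOp μ) with hS
  have hSn : ‖S‖ < 1 := by
    rw [hS, norm_smul, Real.norm_of_nonneg hr0.le, ← hρ, hr, div_mul_eq_mul_div,
      div_mul_eq_mul_div, div_lt_one (by positivity)]
    linarith
  have hsum : HasSum (fun k => S ^ k) (∑' k, S ^ k) :=
    (summable_geometric_of_norm_lt_one hSn).hasSum
  set δ : lp (fun _ : Γ => ℝ) 2 := lp.single 2 1 1 with hδ
  -- This nonnegative vector satisfies `(1 - r) u = δ + r P u`, hence `s P u ≤ u`, and also `u ≥ δ`.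
  -- Iterating, `sᵏ μᵏ = sᵏ Pᵏ δ ≤ u ≤ ‖u‖`; no symmetry of `μ` is needed.
  set u := (∑' k, S ^ k) δ with hu
  have hSapp : ∀ f : lp (fun _ : Γ => ℝ) 2, ∀ x, S f x = r * (f x + convOp μ f x) := fun f x => rfl
  have hconv0 : ∀ f : lp (fun _ : Γ => ℝ) 2, (∀ x, 0 ≤ f x) → ∀ x, 0 ≤ convOp μ f x :=
    fun f hf x => (hasSum_convOp_apply_apply μ f x).nonneg fun a =>
      mul_nonneg ENNReal.toReal_nonneg (hf _)
  have hδ0 : ∀ x, 0 ≤ δ x := fun x => by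
    rw [hδ, lp.single_apply, Pi.single_apply]
    split_ifs <;> norm_num
  have hpow0 : ∀ k x, 0 ≤ (S ^ k) δ x := by
    intro k
    induction k with
    | zero => exact hδ0
    | succ k ih =>
      intro x
      rw [pow_succ']
      exact (hSapp _ x).symm ▸ mul_nonneg hr0.le (add_nonneg (ih x) (hconv0 _ ih x))
  have hu0 : ∀ x, 0 ≤ u x := fun x => by
    have h1 : HasSum (fun k => (S ^ k) δ) u := (ContinuousLinearMap.apply ℝ _ δ).hasSum hsum
    exact ((lp.evalCLM ℝ (fun _ : Γ => ℝ) 2 x).hasSum h1).nonneg fun k => hpow0 k x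
  have hueq : u = δ + S u := by
    have h1 := mul_neg_geom_series S hSn
    have h2 := congrArg (fun T => T δ) h1
    simp only [mul_apply_eq_comp, sub_apply,
      one_apply_eq_self, ← hu] at h2
    rw [← h2]
    abel
  have hux : ∀ x, u x = δ x + r * (u x + convOp μ u x) := fun x => by
    rw [← hSapp]
    exact congrArg (fun f : lp (fun _ : Γ => ℝ) 2 => f x) hueq
  refine ⟨r / (1 - r), by rw [lt_div_iff₀ (by linarith)]; linarith, ‖u‖, fun k x => ?_⟩
  have hs0 : 0 ≤ r / (1 - r) := div_nonneg hr0.le (by linarith)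
  refine le_trans ?_ ((le_abs_self (u x)).trans (lp.norm_apply_le_norm (by norm_num) u x))
  induction k generalizing x with
  | zero =>
    have h1 := hux x
    have h2 := hconv0 u hu0 x
    have h3 : ((PMF.pure (1 : Γ)) x).toReal = δ x := by
      rw [hδ, lp.single_apply, Pi.single_apply, PMF.pure_apply]
      split_ifs <;> simp
    rw [pow_zero, one_mul, convPow_zero, h3]
    nlinarith [hu0 x]
  | succ k ih =>
    have h1 : (r / (1 - r)) ^ k * (convPow μ (k + 1) x).toReal ≤ convOp μ u x := by
      rw [convPow_succ']
      refine hasSum_le (fun a => ?_) ((hasSum_conv_apply μ (convPow μ k) x).mul_left _)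
        (hasSum_convOp_apply_apply μ u x)
      rw [mul_left_comm]
      exact mul_le_mul_of_nonneg_left (ih _) ENNReal.toReal_nonneg
    rw [pow_succ', mul_assoc]
    refine (mul_le_mul_of_nonneg_left h1 hs0).trans ?_
    rw [div_mul_eq_mul_div, div_le_iff₀ (by linarith)]
    have := hux x
    nlinarith [hδ0 x]

theorem green_lt_top {μ : PMF Γ} {s C : ℝ} (hs : 1 < s)
    (hdecay : ∀ k x, s ^ k * (convPow μ k x).toReal ≤ C) (x : Γ) : green μ x < ⊤ := by
  have hs0 : 0 < s := by linarith
  have hle : ∀ k, convPow μ k x ≤ ENNReal.ofReal (C * s⁻¹ ^ k) := fun k => by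
    rw [← ENNReal.ofReal_toReal (PMF.apply_ne_top (convPow μ k) x)]
    refine ENNReal.ofReal_le_ofReal ?_
    rw [inv_pow, ← div_eq_mul_inv, le_div_iff₀ (by positivity), mul_comm]
    exact hdecay k x
  have hsum : Summable fun k : ℕ => C * s⁻¹ ^ k :=
    (summable_geometric_of_lt_one (by positivity) (inv_lt_one_of_one_lt₀ hs)).mul_left C
  exact lt_of_le_of_lt (ENNReal.tsum_le_tsum hle) hsum.tsum_ofReal_lt_top

theorem exists_geometric_pmf {t : ℝ} (ht0 : 0 < t) (ht1 : t < 1) :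
    ∃ w : PMF ℕ, ∀ k, w k = ENNReal.ofReal ((1 - t) * t ^ k) := by
  have h0 : ∀ k, 0 ≤ (1 - t) * t ^ k := fun k =>
    mul_nonneg (by linarith) (by positivity)
  have hs : HasSum (fun k : ℕ => (1 - t) * t ^ k) 1 := by
    have h := (hasSum_geometric_of_lt_one ht0.le ht1).mul_left (1 - t)
    rwa [mul_inv_cancel₀ (by linarith)] at h
  refine ⟨⟨fun k => ENNReal.ofReal ((1 - t) * t ^ k), ?_⟩, fun k => rfl⟩
  rw [ENNReal.summable.hasSum_iff, ← ENNReal.ofReal_tsum_of_nonneg h0 hs.summable, hs.tsum_eq,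
    ENNReal.ofReal_one]

/-- On a group where the convolution powers decay exponentially, the Green function is, up to
exponents arbitrarily close to `1`, dominated by a probability measure. -/
theorem exists_pmf_green_le {μ : PMF Γ} {s C : ℝ} (hs : 1 < s)
    (hdecay : ∀ k x, s ^ k * (convPow μ k x).toReal ≤ C)
    (hpos : ∀ x, 0 < green μ x) {θ : ℝ} (hθ0 : 0 ≤ θ) (hθ : θ < 1) :
    ∃ q : PMF Γ, (∀ x, q x ≠ 0) ∧
      ∃ K : ℝ, ∀ x, -(θ * Real.log (q x).toReal) ≤ K - Real.log (green μ x).toReal := by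
  have hs0 : 0 < s := by linarith
  set L := Real.log s with hL
  have hL0 : 0 < L := Real.log_pos hs
  set τ := 1 - θ with hτ
  have hτ0 : 0 < τ := by linarith
  -- Here `t = s^(-τ)`: slow enough decay of the weights of `q` that a small share of the decay of
  -- `μᵏ` compensates for it.
  set t := Real.exp (-(τ * L)) with ht
  have ht0 : 0 < t := Real.exp_pos _
  have ht1 : t < 1 := Real.exp_lt_one_iff.2 (by nlinarith)
  obtain ⟨w, hw⟩ := exists_geometric_pmf ht0 ht1
  set q : PMF Γ := w.bind (convPow μ) with hq
  have hqk : ∀ k x, (1 - t) * t ^ k * (convPow μ k x).toReal ≤ (q x).toReal := fun k x => by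
    have h : w k * convPow μ k x ≤ q x := by
      rw [hq, PMF.bind_apply]
      exact ENNReal.le_tsum (f := fun k => w k * convPow μ k x) k
    have h' := ENNReal.toReal_mono (q.apply_ne_top x) h
    rwa [ENNReal.toReal_mul, hw, ENNReal.toReal_ofReal
      (mul_nonneg (by linarith) (by positivity))] at h'
  have hq0 : ∀ x, q x ≠ 0 := fun x h0 => by
    refine (hpos x).ne' (ENNReal.tsum_eq_zero.2 fun k => ?_)
    by_contra hk
    have h1 := hqk k x
    rw [h0, ENNReal.toReal_zero] at h1
    have h2 : 0 < (convPow μ k x).toReal := ENNReal.toReal_pos hk (PMF.apply_ne_top _ _)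
    have h3 : 0 < (1 - t) * t ^ k * (convPow μ k x).toReal :=
      mul_pos (mul_pos (by linarith) (by positivity)) h2
    linarith
  set b := Real.exp (-(τ ^ 2 * L)) with hb
  have hb1 : b < 1 := Real.exp_lt_one_iff.2 (by have := mul_pos (pow_pos hτ0 2) hL0; linarith)
  have hb0 : 0 < b := Real.exp_pos _
  set B := -(θ * Real.log (1 - t)) + τ * Real.log C with hB
  refine ⟨q, hq0, B - Real.log (1 - b), fun x => ?_⟩
  -- Interpolate with weights `τ` and `θ = 1 - τ` between `μᵏ ≤ C s⁻ᵏ` and `μᵏ ≤ q / ((1 - t) tᵏ)`.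
  -- The exponent of `s` is `-kτ + kθτ = -kτ²`, whence the ratio `b`.
  have hterm : ∀ k, (convPow μ k x).toReal ≤
      Real.exp (θ * Real.log (q x).toReal + B) * b ^ k := by
    intro k
    rcases (ENNReal.toReal_nonneg (a := convPow μ k x)).eq_or_lt with h0 | h0
    · rw [← h0]
      positivity
    have hC0 : 0 < C := lt_of_lt_of_le (by positivity) (hdecay k x)
    have h1 : Real.log (convPow μ k x).toReal ≤ Real.log C - k * L := by
      have h := Real.log_le_log (by positivity) (hdecay k x)
      rw [Real.log_mul (by positivity) h0.ne', Real.log_pow] at h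
      linarith
    have h2 : Real.log (convPow μ k x).toReal ≤
        Real.log (q x).toReal - Real.log (1 - t) + k * (τ * L) := by
      have ht' : 0 < 1 - t := by linarith
      have h := Real.log_le_log (by positivity) (hqk k x)
      rw [Real.log_mul (by positivity) h0.ne', Real.log_mul ht'.ne' (by positivity),
        Real.log_pow, ht, Real.log_exp, ← ht] at h
      linarith
    rw [← Real.exp_log h0, hb, ← Real.exp_nat_mul, ← Real.exp_add, Real.exp_le_exp]
    have h3 := mul_le_mul_of_nonneg_left h1 hτ0.le
    have h4 := mul_le_mul_of_nonneg_left h2 hθ0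
    have h5 : θ = 1 - τ := by rw [hτ]; ring
    rw [hB]
    rw [h5] at h4 ⊢
    linarith
  have hqx : 0 < (q x).toReal := ENNReal.toReal_pos (hq0 x) (q.apply_ne_top x)
  have hfin := (green_lt_top hs hdecay x).ne
  have hG : HasSum (fun k => (convPow μ k x).toReal) (green μ x).toReal := by
    have h := ENNReal.hasSum_toReal (f := fun k => convPow μ k x) hfin
    rwa [← ENNReal.tsum_toReal_eq fun k => PMF.apply_ne_top _ _] at h
  have hGpos : 0 < (green μ x).toReal := ENNReal.toReal_pos (hpos x).ne' hfin
  have hle := hasSum_le hterm hG ((hasSum_geometric_of_lt_one hb0.le hb1).mul_left _)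
  have hb' : 0 < 1 - b := by linarith
  have hlog := Real.log_le_log hGpos hle
  rw [Real.log_mul (Real.exp_pos _).ne' (by positivity), Real.log_exp, Real.log_inv] at hlog
  linarith

/-! ### Entropy and its asymptotic rate. -/

theorem toReal_mul_neg_log {α : Type*} (p : PMF α) (x : α) :
    (p x).toReal * -Real.log (p x).toReal = Real.negMulLog (p x).toReal := by
  rw [Real.negMulLog]
  ring

theorem neg_log_toReal_nonneg {α : Type*} (p : PMF α) (x : α) : 0 ≤ -Real.log (p x).toReal :=
  neg_nonneg.2 (Real.log_nonpos ENNReal.toReal_nonneg (toReal_le_one p x))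

theorem toReal_pos {α : Type*} (p : PMF α) {x : α} (hx : p x ≠ 0) : 0 < (p x).toReal :=
  ENNReal.toReal_pos hx (p.apply_ne_top x)

theorem entropy_nonneg {α : Type*} (p : PMF α) : 0 ≤ entropy p :=
  tsum_nonneg fun x => Real.negMulLog_nonneg ENNReal.toReal_nonneg (toReal_le_one p x)

/-- Gibbs' inequality. -/
theorem entropy_le_tsum {α : Type*} {p q : PMF α} (hq : ∀ x, q x ≠ 0) (hp : HasFiniteEntropy p)
    (hs : Summable fun x => (p x).toReal * -Real.log (q x).toReal) :
    entropy p ≤ ∑' x, (p x).toReal * -Real.log (q x).toReal := by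
  -- Pointwise `-p log p ≤ -p log q + q - p`, from `log z ≤ z - 1` at `z = q / p`; the masses of `q`
  -- and `p` cancel on summing.
  have h := hasSum_le (fun x => ?_) hp.hasSum
    ((hs.hasSum.add (hasSum_toReal q)).sub (hasSum_toReal p))
  · rw [add_sub_cancel_right] at h
    exact h
  · rcases (ENNReal.toReal_nonneg (a := p x)).eq_or_lt with h0 | h0
    · rw [← h0]
      simp
    · have hq0 := toReal_pos q (hq x)
      have h1 := Real.log_le_sub_one_of_pos (div_pos hq0 h0)
      rw [Real.log_div hq0.ne' h0.ne'] at h1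
      have h2 := mul_le_mul_of_nonneg_left h1 h0.le
      rw [mul_sub, mul_sub, mul_div_cancel₀ _ h0.ne'] at h2
      rw [Real.negMulLog]
      linarith

theorem exists_tendsto_div_of_subadditive {u : ℕ → ℝ} (hsub : ∀ m n, u (m + n) ≤ u m + u n)
    (h0 : ∀ n, 0 ≤ u n) : ∃ L, Tendsto (fun n : ℕ => u n / n) atTop (𝓝 L) := by
  have hu : Subadditive u := hsub
  refine ⟨hu.lim, hu.tendsto_lim ⟨0, ?_⟩⟩
  rintro _ ⟨n, rfl⟩
  exact div_nonneg (h0 n) (Nat.cast_nonneg n)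

/-- Since `(p * q)(y a) ≥ p(y) q(a)`, the information `-log` is subadditive along products. -/
theorem hasFiniteEntropy_conv_and_entropy_le {p q : PMF Γ} (hp : HasFiniteEntropy p)
    (hq : HasFiniteEntropy q) :
    HasFiniteEntropy (conv p q) ∧ entropy (conv p q) ≤ entropy p + entropy q := by
  have h := summable_conv_and_tsum_le (p := p) (q := q)
    (F := fun x => -Real.log (conv p q x).toReal) (A := fun x => -Real.log (p x).toReal)
    (B := fun x => -Real.log (q x).toReal) (neg_log_toReal_nonneg _) (fun y a hy ha => by
      have h1 := ENNReal.toReal_mono (PMF.apply_ne_top _ _) (mul_le_conv p q y a)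
      rw [ENNReal.toReal_mul] at h1
      have h2 := Real.log_le_log (mul_pos (toReal_pos p hy) (toReal_pos q ha)) h1
      rw [Real.log_mul (toReal_pos p hy).ne' (toReal_pos q ha).ne'] at h2
      linarith)
    (by simpa only [toReal_mul_neg_log] using! hp)
    (by simpa only [toReal_mul_neg_log] using! hq)
  simpa only [toReal_mul_neg_log] using! h

theorem hasFiniteEntropy_pure_one : HasFiniteEntropy (PMF.pure (1 : Γ)) := by
  classical
  refine summable_zero.congr fun x => ?_
  rw [PMF.pure_apply]
  split_ifs <;> simp

theorem hasFiniteEntropy_convPow {μ : PMF Γ} (hμ : HasFiniteEntropy μ) (n : ℕ) :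
    HasFiniteEntropy (convPow μ n) := by
  induction n with
  | zero => exact hasFiniteEntropy_pure_one
  | succ n ih => exact (hasFiniteEntropy_conv_and_entropy_le ih hμ).1

theorem asymptoticEntropyExists {μ : PMF Γ} (hμ : HasFiniteEntropy μ) :
    AsymptoticEntropyExists μ := by
  refine ⟨hasFiniteEntropy_convPow hμ, tendsto_nhds_limUnder
    (exists_tendsto_div_of_subadditive (fun m n => ?_) fun n => entropy_nonneg _)⟩
  rw [convPow_add]
  exact (hasFiniteEntropy_conv_and_entropy_le (hasFiniteEntropy_convPow hμ m)
    (hasFiniteEntropy_convPow hμ n)).2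

/-! ### The Green metric and the lower bound for its rate of escape. -/

theorem greenMetric_one_apply (μ : PMF Γ) (x : Γ) :
    greenMetric μ 1 x = Real.log (green μ 1).toReal - Real.log (green μ x).toReal := by
  rw [greenMetric, inv_one, one_mul]

theorem greenMetric_one_nonneg {μ : PMF Γ} (hpos : ∀ x, 0 < green μ x)
    (hfin : ∀ x, green μ x < ⊤) (x : Γ) : 0 ≤ greenMetric μ 1 x := by
  rw [greenMetric_one_apply, sub_nonneg]
  exact Real.log_le_log (ENNReal.toReal_pos (hpos x).ne' (hfin x).ne)
    (ENNReal.toReal_mono (hfin 1).ne (green_le_green_one (hfin 1).ne x))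

theorem greenMetric_one_mul_le {μ : PMF Γ} (hpos : ∀ x, 0 < green μ x)
    (hfin : ∀ x, green μ x < ⊤) (x y : Γ) :
    greenMetric μ 1 (x * y) ≤ greenMetric μ 1 x + greenMetric μ 1 y := by
  have hp : ∀ x, 0 < (green μ x).toReal := fun x => ENNReal.toReal_pos (hpos x).ne' (hfin x).ne
  have h := ENNReal.toReal_mono (ENNReal.mul_ne_top (hfin 1).ne (hfin (x * y)).ne)
    (green_mul_green_le (hfin 1).ne x y)
  rw [ENNReal.toReal_mul, ENNReal.toReal_mul] at h
  have h' := Real.log_le_log (mul_pos (hp x) (hp y)) h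
  rw [Real.log_mul (hp _).ne' (hp _).ne', Real.log_mul (hp _).ne' (hp _).ne'] at h'
  simp only [greenMetric_one_apply]
  linarith

theorem rateOfEscapeExists {μ μ₀ : PMF Γ} (hpos : ∀ x, 0 < green μ₀ x)
    (hfin : ∀ x, green μ₀ x < ⊤) (hmean : ∀ n, HasFiniteMean μ (greenMetric μ₀) n) :
    RateOfEscapeExists μ (greenMetric μ₀) := by
  refine ⟨hmean, tendsto_nhds_limUnder (exists_tendsto_div_of_subadditive (fun m n => ?_)
    fun n => tsum_nonneg fun x =>
      mul_nonneg (greenMetric_one_nonneg hpos hfin x) ENNReal.toReal_nonneg)⟩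
  have hm : ∀ n, Summable fun x => (convPow μ n x).toReal * greenMetric μ₀ 1 x := fun n =>
    (hmean n).congr fun x => mul_comm _ _
  have h := (summable_conv_and_tsum_le (greenMetric_one_nonneg hpos hfin)
    (fun y a _ _ => greenMetric_one_mul_le hpos hfin y a) (hm m) (hm n)).2
  rw [← convPow_add] at h
  simpa only [meanDist, mul_comm (greenMetric μ₀ 1 _)] using h

/-- The asymptotic entropy is at most the rate of escape in the Green metric of a walk whose convolution
powers decay exponentially. -/
theorem asymptoticEntropy_le_rateOfEscape {μ μ₀ : PMF Γ} {s C : ℝ} (hs : 1 < s)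
    (hdecay : ∀ k x, s ^ k * (convPow μ₀ k x).toReal ≤ C) (hpos : ∀ x, 0 < green μ₀ x)
    (hent : AsymptoticEntropyExists μ) (hrate : RateOfEscapeExists μ (greenMetric μ₀)) :
    asymptoticEntropy μ ≤ rateOfEscape μ (greenMetric μ₀) := by
  have key : ∀ θ : ℝ, 0 < θ → θ < 1 →
      θ * asymptoticEntropy μ ≤ rateOfEscape μ (greenMetric μ₀) := by
    intro θ hθ0 hθ1
    obtain ⟨q, hq, K, hK⟩ := exists_pmf_green_le hs hdecay hpos hθ0.le hθ1
    set K' := K - Real.log (green μ₀ 1).toReal with hK'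
    have hbound : ∀ n, θ * entropy (convPow μ n) ≤ meanDist μ (greenMetric μ₀) n + K' := by
      intro n
      have hle : ∀ x, θ * ((convPow μ n x).toReal * -Real.log (q x).toReal) ≤
          greenMetric μ₀ 1 x * (convPow μ n x).toReal + (convPow μ n x).toReal * K' := fun x => by
        have h := mul_le_mul_of_nonneg_left (hK x)
          (ENNReal.toReal_nonneg (a := convPow μ n x))
        rw [greenMetric_one_apply, hK']
        linarith
      have hsum := (hrate.1 n).hasSum.add ((hasSum_toReal (convPow μ n)).mul_right K')
      have hs1 := Summable.of_nonneg_of_le (fun x => mul_nonneg hθ0.le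
        (mul_nonneg ENNReal.toReal_nonneg (neg_log_toReal_nonneg q x))) hle hsum.summable
      have hs2 : Summable fun x => (convPow μ n x).toReal * -Real.log (q x).toReal :=
        (summable_mul_left_iff hθ0.ne').1 hs1
      have h1 := mul_le_mul_of_nonneg_left (entropy_le_tsum hq (hent.1 n) hs2) hθ0.le
      have h2 := hasSum_le hle (hs2.hasSum.mul_left θ) hsum
      rw [one_mul] at h2
      exact h1.trans h2
    have hlim1 := hent.2.const_mul θ
    have hlim2 := hrate.2.add (tendsto_const_div_atTop_nhds_zero_nat K')
    rw [add_zero] at hlim2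
    refine le_of_tendsto_of_tendsto' hlim1 hlim2 fun n => ?_
    rw [← mul_div_assoc, ← add_div]
    exact div_le_div_of_nonneg_right (hbound n) (Nat.cast_nonneg n)
  have hlim : Tendsto (fun θ : ℝ => θ * asymptoticEntropy μ) (𝓝[<] 1)
      (𝓝 (1 * asymptoticEntropy μ)) :=
    (tendsto_nhdsWithin_of_tendsto_nhds tendsto_id).mul_const _
  rw [one_mul] at hlim
  refine le_of_tendsto hlim ?_
  filter_upwards [Ioo_mem_nhdsLT (zero_lt_one (α := ℝ))] with θ hθ
  exact key θ hθ.1 hθ.2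

/-! ### Comparable measures and relative entropy. -/

/-- The logarithm of the density of `p` with respect to `q`. -/
noncomputable def logRatio {α : Type*} (p q : PMF α) (x : α) : ℝ :=
  Real.log ((p x).toReal / (q x).toReal)

/-- The two measures have mutual densities bounded by `exp A`. -/
def IsComparable {α : Type*} (p q : PMF α) (A : ℝ) : Prop :=
  ∀ x, p x ≤ ENNReal.ofReal (Real.exp A) * q x ∧ q x ≤ ENNReal.ofReal (Real.exp A) * p x

theorem IsComparable.eq_zero_iff {α : Type*} {p q : PMF α} {A : ℝ} (h : IsComparable p q A)
    (x : α) : p x = 0 ↔ q x = 0 := by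
  constructor <;> intro h0
  · have := (h x).2
    rw [h0, mul_zero] at this
    exact le_antisymm this zero_le
  · have := (h x).1
    rw [h0, mul_zero] at this
    exact le_antisymm this zero_le

theorem IsComparable.toReal_le {α : Type*} {p q : PMF α} {A : ℝ} (h : IsComparable p q A)
    (x : α) : (p x).toReal ≤ Real.exp A * (q x).toReal := by
  have h1 := ENNReal.toReal_mono (ENNReal.mul_ne_top ENNReal.ofReal_ne_top (q.apply_ne_top x))
    (h x).1
  rwa [ENNReal.toReal_mul, ENNReal.toReal_ofReal (Real.exp_pos _).le] at h1

theorem IsComparable.symm {α : Type*} {p q : PMF α} {A : ℝ} (h : IsComparable p q A) :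
    IsComparable q p A := fun x => ⟨(h x).2, (h x).1⟩

theorem IsComparable.div_le {α : Type*} {p q : PMF α} {A : ℝ} (h : IsComparable p q A)
    (x : α) : (p x).toReal / (q x).toReal ≤ Real.exp A :=
  div_le_of_le_mul₀ ENNReal.toReal_nonneg (Real.exp_pos _).le (h.toReal_le x)

theorem IsComparable.abs_logRatio_le {α : Type*} {p q : PMF α} {A : ℝ} (hA : 0 ≤ A)
    (h : IsComparable p q A) (x : α) : |logRatio p q x| ≤ A := by
  by_cases hx : p x = 0
  · simpa [logRatio, hx] using hA
  have hx' : q x ≠ 0 := fun h0 => hx ((h.eq_zero_iff x).2 h0)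
  have hp := toReal_pos p hx
  have hq := toReal_pos q hx'
  rw [abs_le]
  constructor
  · rw [← neg_le_neg_iff, neg_neg, logRatio, ← Real.log_inv, inv_div,
      Real.log_le_iff_le_exp (div_pos hq hp)]
    exact h.symm.div_le x
  · rw [logRatio, Real.log_le_iff_le_exp (div_pos hp hq)]
    exact h.div_le x

theorem summable_toReal_mul_of_bounded {α : Type*} (p : PMF α) {F : α → ℝ} {K : ℝ}
    (hF : ∀ x, |F x| ≤ K) : Summable fun x => (p x).toReal * F x := by
  refine Summable.of_norm_bounded ((hasSum_toReal p).summable.mul_right K) fun x => ?_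
  rw [norm_mul, Real.norm_of_nonneg ENNReal.toReal_nonneg, Real.norm_eq_abs]
  exact mul_le_mul_of_nonneg_left (hF x) ENNReal.toReal_nonneg

/-- The relative entropy of `p` with respect to `q`. -/
noncomputable def relEntropy {α : Type*} (p q : PMF α) : ℝ :=
  ∑' x, (p x).toReal * logRatio p q x

/-- The constant grows with `n`, but it serves only to make log-densities bounded and series
convergent; it does not enter the final estimate. -/
theorem IsComparable.convPow {p q : PMF Γ} {A : ℝ} (h : IsComparable p q A) (n : ℕ) :
    IsComparable (convPow p n) (convPow q n) (n * A) := by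
  have hpow : ENNReal.ofReal (Real.exp (n * A)) = ENNReal.ofReal (Real.exp A) ^ n := by
    rw [Real.exp_nat_mul, ENNReal.ofReal_pow (Real.exp_pos _).le]
  rw [IsComparable, hpow]
  exact fun x => ⟨convPow_le_mul (fun x => (h x).1) n x, convPow_le_mul (fun x => (h x).2) n x⟩

theorem hasSum_prod_of_bounded (p q : PMF Γ) {F : Γ → ℝ} {K : ℝ} (hF : ∀ x, |F x| ≤ K) :
    HasSum (fun z : Γ × Γ => (p z.1).toReal * (q z.2).toReal * F (z.1 * z.2))
      (∑' x, (conv p q x).toReal * F x) := by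
  have hs : Summable fun z : Γ × Γ => (p z.1).toReal * (q z.2).toReal * F (z.1 * z.2) := by
    have h := summable_mul_of_summable_norm (hasSum_toReal p).summable.norm
      (hasSum_toReal q).summable.norm
    refine Summable.of_norm_bounded (h.mul_right K) fun z => ?_
    rw [norm_mul, Real.norm_of_nonneg (mul_nonneg ENNReal.toReal_nonneg ENNReal.toReal_nonneg),
      Real.norm_eq_abs]
    exact mul_le_mul_of_nonneg_left (hF _)
      (mul_nonneg ENNReal.toReal_nonneg ENNReal.toReal_nonneg)
  rw [(hasSum_conv hs.hasSum).tsum_eq]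
  exact hs.hasSum

/-- The relative entropy is subadditive under convolution. -/
theorem relEntropy_conv_le {p q p' q' : PMF Γ} {A A' D : ℝ} (hA : 0 ≤ A) (hA' : 0 ≤ A')
    (hD : 0 ≤ D) (h : IsComparable p q A) (h' : IsComparable p' q' A')
    (hc : IsComparable (conv p p') (conv q q') D) :
    relEntropy (conv p p') (conv q q') ≤ relEntropy p q + relEntropy p' q' := by
  set r : Γ → ℝ := fun x => (conv p p' x).toReal / (conv q q' x).toReal with hr
  have hr0 : ∀ x, 0 ≤ r x := fun x => div_nonneg ENNReal.toReal_nonneg ENNReal.toReal_nonneg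
  have hL := hasSum_prod_mul_add
    (summable_toReal_mul_of_bounded p (h.abs_logRatio_le hA)).hasSum
    (summable_toReal_mul_of_bounded p' (h'.abs_logRatio_le hA')).hasSum
  have h1 := hasSum_prod_of_bounded p p' (hc.abs_logRatio_le hD)
  have h2 := hasSum_prod_of_bounded p p' (F := fun _ => 1) (K := 1) (fun _ => by simp)
  have h3 := hasSum_prod_of_bounded q q' (F := r) (K := Real.exp D)
    (fun x => by rw [abs_of_nonneg (hr0 x)]; exact hc.div_le x)
  have e2 : ∑' x, (conv p p' x).toReal * (1 : ℝ) = 1 := by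
    simp only [mul_one, (hasSum_toReal _).tsum_eq]
  have e3 : ∑' x, (conv q q' x).toReal * r x = 1 := by
    rw [← (hasSum_toReal (conv p p')).tsum_eq]
    refine tsum_congr fun x => ?_
    by_cases hx : conv q q' x = 0
    · rw [hx, (hc.eq_zero_iff x).2 hx]
      simp
    · exact mul_div_cancel₀ _ (toReal_pos _ hx).ne'
  rw [e2] at h2
  rw [e3] at h3
  -- Gibbs' inequality on `Γ × Γ` between `p ⊗ p'` and `q ⊗ q'` reweighted by `r(y a)`, which has
  -- mass one by `e3`.
  have hle := hasSum_le (fun z => ?_) ((h1.add h2).sub h3) hL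
  · rw [add_sub_cancel_right] at hle
    exact hle
  · obtain ⟨y, a⟩ := z
    dsimp only
    by_cases hy : p y = 0
    · simp [hy, (h.eq_zero_iff y).1 hy]
    by_cases ha : p' a = 0
    · simp [ha, (h'.eq_zero_iff a).1 ha]
    have hy' := toReal_pos q (mt (h.eq_zero_iff y).2 hy)
    have ha' := toReal_pos q' (mt (h'.eq_zero_iff a).2 ha)
    replace hy := toReal_pos p hy
    replace ha := toReal_pos p' ha
    have hcp : 0 < (conv p p' (y * a)).toReal := by
      refine lt_of_lt_of_le (mul_pos hy ha) ?_
      rw [← ENNReal.toReal_mul]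
      exact ENNReal.toReal_mono (PMF.apply_ne_top _ _) (mul_le_conv p p' y a)
    have hcq : 0 < (conv q q' (y * a)).toReal := by
      refine lt_of_lt_of_le (mul_pos hy' ha') ?_
      rw [← ENNReal.toReal_mul]
      exact ENNReal.toReal_mono (PMF.apply_ne_top _ _) (mul_le_conv q q' y a)
    have hrpos : 0 < r (y * a) := div_pos hcp hcq
    have hlog : logRatio (conv p p') (conv q q') (y * a) = Real.log (r (y * a)) := rfl
    have hP := mul_pos hy ha
    have hQ := mul_pos (mul_pos hy' ha') hrpos
    have key := mul_le_mul_of_nonneg_left (Real.log_le_sub_one_of_pos (div_pos hQ hP)) hP.le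
    rw [mul_sub, mul_div_cancel₀ _ hP.ne', Real.log_div hQ.ne' hP.ne',
      Real.log_mul (mul_pos hy' ha').ne' hrpos.ne', Real.log_mul hy'.ne' ha'.ne',
      Real.log_mul hy.ne' ha.ne'] at key
    rw [hlog, logRatio, logRatio, Real.log_div hy.ne' hy'.ne', Real.log_div ha.ne' ha'.ne']
    linarith

theorem relEntropy_convPow_le {p q : PMF Γ} {A : ℝ} (hA : 0 ≤ A) (h : IsComparable p q A)
    (n : ℕ) : relEntropy (convPow p n) (convPow q n) ≤ n * relEntropy p q := by
  induction n with
  | zero =>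
    have h0 : ∀ x : Γ, logRatio (PMF.pure (1 : Γ)) (PMF.pure 1) x = 0 := fun x => by
      rw [logRatio, ← Real.log_one]
      by_cases hx : x = 1 <;> simp [PMF.pure_apply, hx]
    simp [relEntropy, convPow_zero, h0]
  | succ n ih =>
    have h1 := relEntropy_conv_le (by positivity) hA (by positivity) (h.convPow n) h
      (h.convPow (n + 1))
    rw [convPow_succ, convPow_succ]
    push_cast
    linarith

/-! ### The upper bound for the rate of escape. -/

theorem meanDist_greenMetric_le {μ μ₀ : PMF Γ} {A : ℝ} (hA : 0 ≤ A) (h : IsComparable μ μ₀ A)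
    (hpos : ∀ x, 0 < green μ₀ x) (hfin : ∀ x, green μ₀ x < ⊤) {n : ℕ}
    (hent : HasFiniteEntropy (convPow μ n)) :
    HasFiniteMean μ (greenMetric μ₀) n ∧
      meanDist μ (greenMetric μ₀) n ≤ Real.log (green μ₀ 1).toReal + entropy (convPow μ n) +
        n * relEntropy μ μ₀ := by
  have hn := h.convPow n
  have hsum := (((hasSum_toReal (convPow μ n)).mul_right (Real.log (green μ₀ 1).toReal)).add
    hent.hasSum).add
      (summable_toReal_mul_of_bounded (convPow μ n) (hn.abs_logRatio_le (by positivity))).hasSum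
  have hle : ∀ x, greenMetric μ₀ 1 x * (convPow μ n x).toReal ≤
      (convPow μ n x).toReal * Real.log (green μ₀ 1).toReal +
        Real.negMulLog (convPow μ n x).toReal +
        (convPow μ n x).toReal * logRatio (convPow μ n) (convPow μ₀ n) x := fun x => by
    by_cases hx : convPow μ n x = 0
    · simp [hx]
    have hx' := toReal_pos _ (mt (hn.eq_zero_iff x).2 hx)
    replace hx := toReal_pos _ hx
    -- A single term of the Green series suffices: `-log G ≤ -log μ₀ⁿ`, and the right side splits as
    -- `-log μⁿ` plus the log-density.
    have h1 := Real.log_le_log hx' (ENNReal.toReal_mono (hfin x).ne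
      (show convPow μ₀ n x ≤ green μ₀ x from ENNReal.le_tsum n))
    have h2 := mul_le_mul_of_nonneg_left h1 hx.le
    rw [greenMetric_one_apply, logRatio, Real.log_div hx.ne' hx'.ne', Real.negMulLog]
    linarith
  have hm : HasFiniteMean μ (greenMetric μ₀) n := Summable.of_nonneg_of_le
    (fun x => mul_nonneg (greenMetric_one_nonneg hpos hfin x) ENNReal.toReal_nonneg)
    hle hsum.summable
  refine ⟨hm, ?_⟩
  have h1 := hasSum_le hle hm.hasSum hsum
  rw [one_mul] at h1
  exact h1.trans (add_le_add_right (relEntropy_convPow_le hA h n) _)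

theorem rateOfEscape_le_add_relEntropy {μ μ₀ : PMF Γ} {A : ℝ} (hA : 0 ≤ A)
    (h : IsComparable μ μ₀ A) (hpos : ∀ x, 0 < green μ₀ x) (hfin : ∀ x, green μ₀ x < ⊤)
    (hent : AsymptoticEntropyExists μ) (hrate : RateOfEscapeExists μ (greenMetric μ₀)) :
    rateOfEscape μ (greenMetric μ₀) ≤ asymptoticEntropy μ + relEntropy μ μ₀ := by
  have hlim := ((tendsto_const_div_atTop_nhds_zero_nat (Real.log (green μ₀ 1).toReal)).add
    hent.2).add_const (relEntropy μ μ₀)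
  rw [zero_add] at hlim
  refine le_of_tendsto_of_tendsto hrate.2 hlim ?_
  filter_upwards [eventually_gt_atTop 0] with n hn
  have hn' : (0 : ℝ) < n := Nat.cast_pos.2 hn
  have h1 := (meanDist_greenMetric_le hA h hpos hfin (hent.1 n)).2
  rw [← add_div, div_add' _ _ _ hn'.ne', div_le_div_iff_of_pos_right hn']
  linarith

/-! ### Small perturbations. -/

theorem IsComparable.hasFiniteEntropy {α : Type*} {p q : PMF α} {A : ℝ} (hA : 0 ≤ A)
    (h : IsComparable p q A) (hq : HasFiniteEntropy q) : HasFiniteEntropy p := by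
  refine Summable.of_nonneg_of_le
    (fun x => Real.negMulLog_nonneg ENNReal.toReal_nonneg (toReal_le_one p x)) (fun x => ?_)
    ((hq.add ((hasSum_toReal q).summable.mul_right A)).mul_left (Real.exp A))
  by_cases hx : p x = 0
  · simp [hx, (h.eq_zero_iff x).1 hx]
  have hx' := toReal_pos q (mt (h.eq_zero_iff x).2 hx)
  replace hx := toReal_pos p hx
  have h1 := (abs_le.1 (h.abs_logRatio_le hA x)).1
  rw [logRatio, Real.log_div hx.ne' hx'.ne'] at h1
  have h2 : Real.negMulLog (p x).toReal ≤ (p x).toReal * (-Real.log (q x).toReal + A) := by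
    rw [Real.negMulLog, neg_mul, ← mul_neg]
    exact mul_le_mul_of_nonneg_left (by linarith) hx.le
  refine h2.trans ((mul_le_mul_of_nonneg_right (h.toReal_le x)
    (add_nonneg (neg_log_toReal_nonneg q x) hA)).trans_eq ?_)
  rw [Real.negMulLog]
  ring

theorem isComparable_of_eq_mul_exp {α : Type*} {p q : PMF α} {w : α → ℝ} {M : ℝ}
    (h : ∀ x, p x = q x * ENNReal.ofReal (Real.exp (w x))) (hw : ∀ x, |w x| ≤ M) :
    IsComparable p q M := by
  refine fun x => ⟨?_, ?_⟩
  · rw [h, mul_comm]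
    gcongr
    exact (abs_le.1 (hw x)).2
  · rw [h, mul_left_comm, ← ENNReal.ofReal_mul (Real.exp_pos _).le, ← Real.exp_add]
    refine le_mul_of_one_le_right' ?_
    rw [ENNReal.one_le_ofReal, Real.one_le_exp_iff]
    linarith [(abs_le.1 (hw x)).1]

/-- The relative entropy of a small perturbation is quadratic in the size of the perturbation. -/
theorem relEntropy_le_sq {α : Type*} {p q : PMF α} {w : α → ℝ} {M : ℝ}
    (h : ∀ x, p x = q x * ENNReal.ofReal (Real.exp (w x))) (hw : ∀ x, |w x| ≤ M) (hM : M ≤ 1) :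
    relEntropy p q ≤ M ^ 2 := by
  have h' : ∀ x, (p x).toReal = (q x).toReal * Real.exp (w x) := fun x => by
    rw [h, ENNReal.toReal_mul, ENNReal.toReal_ofReal (Real.exp_pos _).le]
  have heq : ∀ x, (p x).toReal * logRatio p q x = (p x).toReal * w x := fun x => by
    rcases (ENNReal.toReal_nonneg (a := q x)).eq_or_lt with h0 | h0
    · rw [h', ← h0]
      simp
    · rw [logRatio, h', mul_div_cancel_left₀ _ h0.ne', Real.log_exp]
  have hs : Summable fun x => (p x).toReal * w x := summable_toReal_mul_of_bounded p hw
  have hle := hasSum_le (fun x => ?_) hs.hasSum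
    (((hasSum_toReal p).sub (hasSum_toReal q)).add ((hasSum_toReal p).mul_right (M ^ 2)))
  · rw [sub_self, zero_add, one_mul] at hle
    rw [relEntropy, tsum_congr heq]
    exact hle
  -- From `e^(-w) ≤ 1 - w + w²` for `|w| ≤ 1`, one gets `p w ≤ p - q + M² p`. The part `p - q` sums
  -- to zero, leaving only the quadratic term.
  · have h1 := (abs_le.1 (Real.abs_exp_sub_one_sub_id_le (x := -w x)
      (by rw [abs_neg]; exact (hw x).trans hM))).2
    have h2 : (-w x) ^ 2 ≤ M ^ 2 := by
      rw [neg_sq]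
      exact sq_le_sq' (by linarith [(abs_le.1 (hw x)).1]) (abs_le.1 (hw x)).2
    have h3 : (q x).toReal = (p x).toReal * Real.exp (-w x) := by
      rw [h', mul_assoc, ← Real.exp_add, add_neg_cancel, Real.exp_zero, mul_one]
    rw [h3]
    have h4 : (p x).toReal * Real.exp (-w x) ≤ (p x).toReal * (1 - w x + M ^ 2) :=
      mul_le_mul_of_nonneg_left (by linarith) ENNReal.toReal_nonneg
    linarith

theorem eq_mul_exp_of_log_eq {x y : ℝ≥0∞} {w : ℝ}
    (h : ENNReal.log x = ENNReal.log y + (w : EReal)) :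
    x = y * ENNReal.ofReal (Real.exp w) := by
  rw [← ENNReal.exp_log x, h, EReal.exp_add, ENNReal.exp_log, EReal.exp_coe]

end GreenSpeed

theorem proposition4p1 {Γ : Type*} [Group Γ] (hfg : Group.FG Γ)
    (hna : ¬ GreenSpeed.IsAmenable Γ)
    (μ : ℝ → PMF Γ) (ν : Γ → ℝ) (o : ℝ → Γ → ℝ)
    (hgen : Subsemigroup.closure (μ 0).support = ⊤)
    (hent : GreenSpeed.HasFiniteEntropy (μ 0))
    (hreg : GreenSpeed.IsRegularCurve μ ν o) :
    (∀ x, 0 < GreenSpeed.green (μ 0) x ∧ GreenSpeed.green (μ 0) x < ⊤) ∧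
    (∀ᶠ t in 𝓝[>] (0 : ℝ), GreenSpeed.AsymptoticEntropyExists (μ t) ∧
      GreenSpeed.RateOfEscapeExists (μ t) (GreenSpeed.greenMetric (μ 0))) ∧
    Tendsto (fun t : ℝ => (1 / t) * (GreenSpeed.asymptoticEntropy (μ t) -
      GreenSpeed.rateOfEscape (μ t) (GreenSpeed.greenMetric (μ 0)))) (𝓝[>] 0) (𝓝 0) := by
  open GreenSpeed in
  obtain ⟨s, hs, C, hdecay⟩ := exists_exponential_decay hna hgen
  have hpos := green_pos hgen
  have hfin := green_lt_top hs hdecay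
  obtain ⟨hlog, ⟨B, hB⟩, ho⟩ := hreg
  have hB0 : 0 ≤ B := (abs_nonneg _).trans (hB 1)
  have ho1 : ∀ᶠ t in 𝓝[>] (0 : ℝ), ∀ a, |o t a| < 1 := by
    have h := Metric.tendstoUniformly_iff.1 ho 1 one_pos
    simp only [dist_zero_left, Real.norm_eq_abs] at h
    exact h.filter_mono (nhdsWithin_mono _ fun t ht => ne_of_gt ht)
  have hsmall : ∀ᶠ t in 𝓝[>] (0 : ℝ), AsymptoticEntropyExists (μ t) ∧
      RateOfEscapeExists (μ t) (greenMetric (μ 0)) ∧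
      asymptoticEntropy (μ t) ≤ rateOfEscape (μ t) (greenMetric (μ 0)) ∧
      rateOfEscape (μ t) (greenMetric (μ 0)) ≤
        asymptoticEntropy (μ t) + (t * (B + 1)) ^ 2 := by
    have hpos' : (0 : ℝ) < 1 / (B + 1) := by positivity
    -- The exponent `t ν + t o_t` is at most `t (B + 1)` in absolute value, and `t ≤ 1 / (B + 1)`
    -- keeps this within the range `M ≤ 1` of the quadratic estimate.
    filter_upwards [ho1, Ioc_mem_nhdsGT hpos'] with t ht ⟨ht0, ht1⟩
    have hM : t * (B + 1) ≤ 1 := by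
      rwa [le_div_iff₀ (by positivity)] at ht1
    have ht1' : t ≤ 1 := ht1.trans (by rw [div_le_one (by positivity)]; linarith)
    have hM0 : 0 ≤ t * (B + 1) := by positivity
    have heq : ∀ a, μ t a = μ 0 a * ENNReal.ofReal (Real.exp (t * ν a + t * o t a)) := fun a =>
      eq_mul_exp_of_log_eq (hlog t ⟨by linarith, ht1'⟩ a)
    have hw : ∀ a, |t * ν a + t * o t a| ≤ t * (B + 1) := fun a => by
      rw [← mul_add, abs_mul, abs_of_pos ht0]
      exact mul_le_mul_of_nonneg_left ((abs_add_le _ _).trans (add_le_add (hB a) (ht a).le)) ht0.le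
    have hcomp := isComparable_of_eq_mul_exp heq hw
    have hE := asymptoticEntropyExists (hcomp.hasFiniteEntropy hM0 hent)
    have hR := rateOfEscapeExists hpos hfin fun n =>
      (meanDist_greenMetric_le hM0 hcomp hpos hfin (hE.1 n)).1
    exact ⟨hE, hR, asymptoticEntropy_le_rateOfEscape hs hdecay hpos hE hR,
      (rateOfEscape_le_add_relEntropy hM0 hcomp hpos hfin hE hR).trans
        (add_le_add_right (relEntropy_le_sq heq hw hM) _)⟩
  refine ⟨fun x => ⟨hpos x, hfin x⟩, hsmall.mono fun t ht => ⟨ht.1, ht.2.1⟩, ?_⟩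
  have hlim : Tendsto (fun t : ℝ => t * (B + 1) ^ 2) (𝓝[>] 0) (𝓝 0) := by
    have h : Tendsto (fun t : ℝ => t * (B + 1) ^ 2) (𝓝 0) (𝓝 (0 * (B + 1) ^ 2)) :=
      tendsto_id.mul_const _
    rw [zero_mul] at h
    exact tendsto_nhdsWithin_of_tendsto_nhds h
  refine squeeze_zero_norm' ?_ hlim
  filter_upwards [hsmall, self_mem_nhdsWithin] with t ⟨_, _, h1, h2⟩ ht
  have ht0 : (0 : ℝ) < t := ht
  rw [Real.norm_eq_abs, abs_mul, abs_of_pos (one_div_pos.2 ht0), abs_sub_comm,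
    abs_of_nonneg (sub_nonneg.2 h1), one_div, inv_mul_le_iff₀ ht0]
  linarith [mul_pow t (B + 1) 2, sq t]
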